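/- Let $\mathbb{Q}(t)$ be the field of rational functions over $\mathbb{Q}$, let $T$ be the complete theory of $(\mathbb{R},<,+,0,1)$, and let $\mathcal{L}_t$ be the language $\{<,+,0,1\}$ together with a unary function symbol $\lambda_q$ for each $q\in\mathbb{Q}(t)$. Let $T_t$ be the $\mathcal{L}_t$-theory extending $T$ by axioms stating, for a model with underlying set $M$: (T1) $(M,+,0,(\lambda_q)_{q\in\mathbb{Q}(t)})$ is a $\mathbb{Q}(t)$-vector space; (T2) for all $m$ and all $\mathbb{Q}$-linearly independent $q_1,\dots,q_m\in\mathbb{Q}(t)$, the image of $x\mapsto(\lambda_{q_1}(x),\dots,\lambda_{q_m}(x))$ is dense in $M^m$ (for the product of the order topology). For a theory $T'$, an inp-pattern of depth $\aleph_0$ in a tuple of variables $x$ of length $n$ consists of formulas $\varphi_j(x;y_j)$, integers $k_j$ and tuples $b_{j,i}$ $(i,j\in\mathbb{N})$ from a model of $T'$ such that, for each $j$, the row $\{\varphi_j(x;b_{j,i}) : i\in\mathbb{N}\}$ is $k_j$-inconsistent, and for each $f:\mathbb{N}\to\mathbb{N}$ the path $\{\varphi_j(x;b_{j,f(j)}) :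 j\in\mathbb{N}\}$ is consistent (i.e. realized in an elementary extension). An ict-pattern of depth $\aleph_0$ consists of formulas $\varphi_j(x;y_j)$ and tuples $b_{j,i}$ such that for each $f:\mathbb{N}\to\mathbb{N}$ the set $\{\varphi_j(x;b_{j,f(j)}) : j\in\mathbb{N}\}\cup\{\neg\varphi_j(x;b_{j,i}) : i,j\in\mathbb{N},\ i\neq f(j)\}$ is consistent. The theory $T'$ is strong if for no $n$ it has an inp-pattern of depth $\aleph_0$ in $n$ variables. **Proposition.** No completion of $T_t$ is strong. In particular, every completion of $T_t$ has infinite burden and infinite dp-rank: already in a single variable $x$ it has an inp-pattern of depth $\aleph_0$ and an ict-pattern of depth $\aleph_0$. -/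

import Mathlib

open FirstOrder FirstOrder.Language

namespace DenseVS

universe u v

/-! ### Consistency, inp-patterns, ict-patterns, strong theories -/

section Patterns

variable {L : FirstOrder.Language.{u, v}}

/-- A family of formulas `φ k (x; b k)` in the variables `x = (x_1, …, x_n)`, with parameters `b k`
from `M`, is consistent: it is realized by one tuple in some elementary extension of `M`. -/
def Consistent {M : Type (max u v)} [L.Structure M] {κ : Type} (n : ℕ) {m : κ → ℕ}
    (φ : ∀ k, L.Formula (Fin n ⊕ Fin (m k))) (b : ∀ k, Fin (m k) → M) : Prop :=
  ∃ (N : Type (max u v)) (_ : L.Structure N) (g : M ↪ₑ[L] N) (a : Fin n → N),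
    ∀ k, (φ k).Realize (Sum.elim a (g ∘ b k))

/-- `T` has an inp-pattern (independent partition pattern) of depth `ι` in `n` variables:
in some model `M` of `T` there are formulas `φ α (x; y_α)`, integers `k α`, and an array
`b α i` (`α` in `ι`, `i` in `ℕ`) of parameter tuples such that
each row `{φ α (x; b α i) : i}` is `k α`-inconsistent and
each path `{φ α (x; b α (f α)) : α}` is consistent. -/
def HasInpPattern (T : L.Theory) (n : ℕ) (ι : Type) : Prop :=
  ∃ (M : Theory.ModelType.{u, v, max u v} T) (m : ι → ℕ)
    (φ : ∀ α, L.Formula (Fin n ⊕ Fin (m α))) (k : ι → ℕ) (b : ∀ α, ℕ → Fin (m α) → M),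
    (∀ α, ∀ s : Finset ℕ, s.card = k α →
      ¬ Consistent n (fun _ : s => φ α) (fun i : s => b α i)) ∧
    (∀ f : ι → ℕ, Consistent n φ (fun α => b α (f α)))

open Classical in
/-- `T` has an ict-pattern of depth `ι` in `n` variables: in some model `M` of `T` there are
formulas `φ α (x; y_α)` and an array `b α i` of parameter tuples such that, for every path `f`,
`{φ α (x; b α (f α)) : α} ∪ {¬ φ α (x; b α i) : α, i ≠ f α}` is consistent. -/
def HasIctPattern (T : L.Theory) (n : ℕ) (ι : Type) : Prop :=
  ∃ (M : Theory.ModelType.{u, v, max u v} T) (m : ι → ℕ)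
    (φ : ∀ α, L.Formula (Fin n ⊕ Fin (m α))) (b : ∀ α, ℕ → Fin (m α) → M),
    ∀ f : ι → ℕ,
      Consistent (κ := ι × ℕ) (m := fun p => m p.1) n
        (fun p => if p.2 = f p.1 then φ p.1 else ∼(φ p.1)) (fun p => b p.1 p.2)

/-- `T` is strong: there is no inp-pattern of infinite depth in finitely many variables.
(A pattern of any infinite depth restricts to one of depth `ℕ`.) -/
def IsStrong (T : L.Theory) : Prop :=
  ∀ n : ℕ, ¬ HasInpPattern T n ℕ

/-- `T'` is a completion of `T`: a complete (in particular satisfiable) theory extending `T`. -/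
def IsCompletion (T' T : L.Theory) : Prop :=
  T ⊆ T' ∧ T'.IsComplete

end Patterns

/-! ### The languages and the theory `T_t` -/

/-- Function symbols `+`, `0`, `1`. -/
inductive BaseFunc : ℕ → Type
  | add : BaseFunc 2
  | zero : BaseFunc 0
  | one : BaseFunc 0

/-- The relation symbol `<`. -/
inductive BaseRel : ℕ → Type
  | lt : BaseRel 2

/-- The language `{<, +, 0, 1}`. -/
def baseLang : FirstOrder.Language.{0, 0} := ⟨BaseFunc, BaseRel⟩

/-- The standard structure `(ℝ, <, +, 0, 1)`. -/
noncomputable instance realStructure : baseLang.Structure ℝ where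
  funMap := fun {_} f => match f with
    | .add => fun v => v 0 + v 1
    | .zero => fun _ => 0
    | .one => fun _ => 1
  RelMap := fun {_} r => match r with
    | .lt => fun v => v 0 < v 1

/-- One unary function symbol `λ_q` for each rational function `q` in `ℚ(t)`. -/
inductive ScalarFunc : ℕ → Type
  | lam (q : RatFunc ℚ) : ScalarFunc 1

/-- The language of the scalar multiplications. -/
def scalarLang : FirstOrder.Language.{0, 0} := ⟨ScalarFunc, fun _ => Empty⟩

/-- The language `{<, +, 0, 1} ∪ {λ_q : q ∈ ℚ(t)}`. -/
abbrev tLang : FirstOrder.Language.{0, 0} := baseLang.sum scalarLang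

section Terms

variable {β : Type}

/-- The term `s + t`. -/
def addT (s t : tLang.Term β) : tLang.Term β :=
  Functions.apply₂ (L := tLang) (Sum.inl BaseFunc.add) s t

/-- The term `λ_q(s)`. -/
def lamT (q : RatFunc ℚ) (s : tLang.Term β) : tLang.Term β :=
  Functions.apply₁ (L := tLang) (Sum.inr (ScalarFunc.lam q)) s

/-- The formula `s < t`. -/
def ltF (s t : tLang.Term β) : tLang.Formula β :=
  Relations.formula₂ (L := tLang) (Sum.inl BaseRel.lt) s t

end Terms

/-- The variable `x_i` in a formula all of whose variables get universally quantified. -/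
def bv {m : ℕ} (i : Fin m) : tLang.Term (Empty ⊕ Fin m) := Term.var (Sum.inr i)

/-- The vector space axioms for the scalar multiplications (that `(M, +, 0)` is an abelian group
belongs to the theory of `(ℝ, <, +, 0, 1)`). -/
inductive IsVectorSpaceAxiom : tLang.Sentence → Prop
  | smul_add (q : RatFunc ℚ) : IsVectorSpaceAxiom
      (Formula.iAlls (Fin 2)
        (Term.equal (lamT q (addT (bv 0) (bv 1))) (addT (lamT q (bv 0)) (lamT q (bv 1)))))
  | add_smul (p q : RatFunc ℚ) : IsVectorSpaceAxiom
      (Formula.iAlls (Fin 1)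
        (Term.equal (lamT (p + q) (bv 0)) (addT (lamT p (bv 0)) (lamT q (bv 0)))))
  | mul_smul (p q : RatFunc ℚ) : IsVectorSpaceAxiom
      (Formula.iAlls (Fin 1)
        (Term.equal (lamT (p * q) (bv 0)) (lamT p (lamT q (bv 0)))))
  | one_smul : IsVectorSpaceAxiom
      (Formula.iAlls (Fin 1) (Term.equal (lamT 1 (bv 0)) (bv 0)))

/-- The sentence saying that the image of `x ↦ (λ_{q_1}(x), …, λ_{q_m}(x))` is dense in `M^m`, i.e.
meets every open box: for all `a, b`, if `a_i < b_i` for all `i`, then there is `x` such that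
`a_i < λ_{q_i}(x) < b_i` for all `i`. -/
noncomputable def denseImage {m : ℕ} (q : Fin m → RatFunc ℚ) : tLang.Sentence :=
  Formula.iAlls (Fin m ⊕ Fin m)
    ((Formula.iInf fun i : Fin m =>
        ltF (Term.var (Sum.inr (Sum.inl i))) (Term.var (Sum.inr (Sum.inr i)))).imp
      (Formula.iExs (Fin 1)
        (Formula.iInf fun i : Fin m =>
          ltF (Term.var (Sum.inl (Sum.inr (Sum.inl i)))) (lamT (q i) (Term.var (Sum.inr 0))) ⊓
          ltF (lamT (q i) (Term.var (Sum.inr 0))) (Term.var (Sum.inl (Sum.inr (Sum.inr i)))))))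

/-- The theory `T_t`: the theory `T` of `(ℝ, <, +, 0, 1)`, the axioms of `ℚ(t)`-vector spaces, and
density of the image of `(λ_{q_1}, …, λ_{q_m})` for all `ℚ`-linearly independent `q_1, …, q_m`. -/
def theoryT : tLang.Theory :=
  (LHom.sumInl : baseLang →ᴸ tLang).onTheory (baseLang.completeTheory ℝ) ∪
    {ψ | IsVectorSpaceAxiom ψ} ∪
    {ψ | ∃ (m : ℕ) (q : Fin m → RatFunc ℚ), LinearIndependent ℚ q ∧ ψ = denseImage q}

end DenseVS

/-! The powers `1, t, t², …` are `ℚ`-linearly independent in `ℚ(t)`, so by density the values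
`λ_{t^j}(x)`, for finitely many `j`, can be steered independently into arbitrary open intervals
(`exists_lam_mem_box`). Fix an increasing sequence `c` and let the entry `(j, i)` of the array say
`c i < λ_{t^j}(x) < c (i + 1)`. Intervals of one row are disjoint, so rows are 2-inconsistent;
finite parts of paths are realized by density, hence whole paths are consistent by compactness
(`consistent_of_forall_initial`). Disjointness also makes a realization of a path refute every entry
off that path, so the same array is an ict-pattern. -/

open Filter

namespace DenseVS

universe u v

section Compactness

variable {L : FirstOrder.Language.{u, v}}

/-- The diagonal elementary embedding of a structure into an ultrapower. -/
def diagonalEmbedding {I : Type*} (U : Ultrafilter I) (M : Type*) [L.Structure M] [Nonempty M] :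
    M ↪ₑ[L] (U : Filter I).Product (fun _ => M) where
  toFun x := ((fun _ => x : I → M) : (U : Filter I).Product (fun _ => M))
  map_formula' _ φ x :=
    (Ultraproduct.realize_formula_cast (u := U) φ (fun i _ => x i)).trans eventually_const

/-- Compactness for countable families of formulas: if all finite initial parts of the family are
realized in `M`, then the family is consistent. -/
theorem consistent_of_forall_initial {M : Type (max u v)} [L.Structure M] [Nonempty M] {n : ℕ}
    {m : ℕ → ℕ} {φ : ∀ k, L.Formula (Fin n ⊕ Fin (m k))} {b : ∀ k, Fin (m k) → M}
    (h : ∀ r : ℕ, ∃ a : Fin n → M, ∀ k < r, (φ k).Realize (Sum.elim a (b k))) :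
    Consistent n φ b := by
  choose a ha using h
  -- A nonprincipal ultrafilter contains `{r | k < r}` for each `k`, so the class of `r ↦ a r`
  -- realizes every `φ k` by Łoś.
  let U : Ultrafilter ℕ := hyperfilter ℕ
  refine ⟨(U : Filter ℕ).Product (fun _ => M), inferInstance, diagonalEmbedding U M,
    fun i => ((fun r => a r i : ℕ → M) : (U : Filter ℕ).Product (fun _ => M)), fun k => ?_⟩
  have key := (Ultraproduct.realize_formula_cast (u := U) (M := fun _ => M) (φ k)
    (Sum.elim (fun i r => a r i) (fun i _ => b k i))).2 (by
      have hk : ∀ᶠ r : ℕ in U, k < r :=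
        (eventually_gt_atTop k).filter_mono Nat.hyperfilter_le_atTop
      filter_upwards [hk] with r hr
      convert ha r k hr using 1
      ext i
      cases i <;> rfl)
  have hv : ∀ w w' : Fin n ⊕ Fin (m k) → (U : Filter ℕ).Product (fun _ => M),
      w = w' → (φ k).Realize w' → (φ k).Realize w := fun _ _ h h' => h ▸ h'
  exact hv _ _ (funext fun i => by cases i <;> rfl) key

end Compactness

/-! ### Order and density in models of `T_t` -/

section Models

/-- The interpretation of the symbol `<` in a structure. -/
def Lt {M : Type} [tLang.Structure M] (x y : M) : Prop :=
  Structure.RelMap (L := tLang) (Sum.inl BaseRel.lt : tLang.Relations 2) ![x, y]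

/-- The interpretation of the symbol `λ_q` in a structure. -/
def lam {M : Type} [tLang.Structure M] (q : RatFunc ℚ) (x : M) : M :=
  Structure.funMap (L := tLang) (Sum.inr (ScalarFunc.lam q) : tLang.Functions 1) ![x]

variable {M : Type} [tLang.Structure M]

@[simp] theorem realize_ltF {β : Type} {s t : tLang.Term β} {v : β → M} :
    (ltF s t).Realize v ↔ Lt (s.realize v) (t.realize v) :=
  Formula.realize_rel₂

@[simp] theorem realize_lamT {β : Type} {q : RatFunc ℚ} {s : tLang.Term β} {v : β → M} :
    (lamT q s).realize v = lam q (s.realize v) :=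
  Term.realize_functions_apply₁

/-- The formula `s < t` of the language `{<, +, 0, 1}`. -/
def baseLtF {β : Type} (s t : baseLang.Term β) : baseLang.Formula β :=
  Relations.formula₂ (L := baseLang) BaseRel.lt s t

theorem realize_baseLtF_real {β : Type} {s t : baseLang.Term β} {v : β → ℝ} :
    (baseLtF s t).Realize v ↔ s.realize v < t.realize v :=
  Formula.realize_rel₂

variable (M) in
/-- Sentences true in `(ℝ, <, +, 0, 1)` hold in the reducts of models of `T_t`. -/
theorem realize_reduct_of_real [hM : M ⊨ theoryT] {ψ : baseLang.Sentence} (h : ℝ ⊨ ψ) :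
    letI := (LHom.sumInl : baseLang →ᴸ tLang).reduct M
    M ⊨ ψ := by
  let _ := (LHom.sumInl : baseLang →ᴸ tLang).reduct M
  rw [← LHom.realize_onSentence M (LHom.sumInl : baseLang →ᴸ tLang)]
  exact Theory.realize_sentence_of_mem theoryT (Or.inl (Or.inl ⟨ψ, h, rfl⟩))

theorem realize_baseLtF_reduct {β : Type} {s t : baseLang.Term β} {v : β → M} :
    letI := (LHom.sumInl : baseLang →ᴸ tLang).reduct M
    (baseLtF s t).Realize v ↔ Lt (s.realize v) (t.realize v) := by
  let _ := (LHom.sumInl : baseLang →ᴸ tLang).reduct M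
  exact Formula.realize_rel₂

variable [hM : M ⊨ theoryT]

include hM

theorem Lt.irrefl (x : M) : ¬ Lt x x := by
  let _ := (LHom.sumInl : baseLang →ᴸ tLang).reduct M
  -- The order axioms are not listed in `T_t`; they are inherited from the theory of `ℝ` by writing
  -- each as a sentence.
  have h := realize_reduct_of_real M (ψ := Formula.iAlls (Fin 1)
    (∼(baseLtF (Term.var (Sum.inr 0)) (Term.var (Sum.inr 0)))))
    (by simp [Sentence.Realize, realize_baseLtF_real])
  simp only [Sentence.Realize, Formula.realize_iAlls, Formula.realize_not,
    realize_baseLtF_reduct] at h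
  exact h fun _ => x

theorem Lt.trans {x y z : M} (hxy : Lt x y) (hyz : Lt y z) : Lt x z := by
  let _ := (LHom.sumInl : baseLang →ᴸ tLang).reduct M
  have h := realize_reduct_of_real M (ψ := Formula.iAlls (Fin 3)
    ((baseLtF (Term.var (Sum.inr 0)) (Term.var (Sum.inr 1))).imp
      ((baseLtF (Term.var (Sum.inr 1)) (Term.var (Sum.inr 2))).imp
        (baseLtF (Term.var (Sum.inr 0)) (Term.var (Sum.inr 2))))))
    (by
      simp only [Sentence.Realize, Formula.realize_iAlls, Formula.realize_imp,
        realize_baseLtF_real]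
      exact fun _ => lt_trans)
  simp only [Sentence.Realize, Formula.realize_iAlls, Formula.realize_imp,
    realize_baseLtF_reduct] at h
  exact h ![x, y, z] hxy hyz

theorem exists_Lt (x : M) : ∃ y, Lt x y := by
  let _ := (LHom.sumInl : baseLang →ᴸ tLang).reduct M
  have h := realize_reduct_of_real M (ψ := Formula.iAlls (Fin 1) (Formula.iExs (Fin 1)
    (baseLtF (Term.var (Sum.inl (Sum.inr 0))) (Term.var (Sum.inr 0)))))
    (by
      simp only [Sentence.Realize, Formula.realize_iAlls, Formula.realize_iExs,
        realize_baseLtF_real]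
      exact fun i => ⟨fun _ => i 0 + 1, lt_add_one (i 0)⟩)
  simp only [Sentence.Realize, Formula.realize_iAlls, Formula.realize_iExs,
    realize_baseLtF_reduct] at h
  obtain ⟨y, hy⟩ := h fun _ => x
  exact ⟨y 0, hy⟩

theorem exists_lam_mem_box {m : ℕ} {q : Fin m → RatFunc ℚ} (hq : LinearIndependent ℚ q)
    {a b : Fin m → M} (hab : ∀ i, Lt (a i) (b i)) :
    ∃ x : M, ∀ i, Lt (a i) (lam (q i) x) ∧ Lt (lam (q i) x) (b i) := by
  have h : M ⊨ denseImage q :=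
    Theory.realize_sentence_of_mem theoryT (Or.inr ⟨m, q, hq, rfl⟩)
  simp only [denseImage, Sentence.Realize, Formula.realize_iAlls, Formula.realize_imp,
    Formula.realize_iExs, Formula.realize_iInf, Formula.realize_inf, realize_ltF, realize_lamT,
    Term.realize_var] at h
  obtain ⟨x, hx⟩ := h (Sum.elim a b) hab
  exact ⟨x 0, hx⟩

/-- A model of `T_t` contains a sequence increasing at each step. -/
theorem exists_increasing_sequence [Nonempty M] : ∃ c : ℕ → M, ∀ i, Lt (c i) (c (i + 1)) := by
  choose s hs using exists_Lt (M := M)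
  refine ⟨fun i => s^[i] (Classical.arbitrary M), fun i => ?_⟩
  simpa only [Function.iterate_succ_apply'] using hs _

/-- The intervals between consecutive terms of an increasing sequence are disjoint. -/
theorem eq_of_mem_intervals {c : ℕ → M} (hc : ∀ i, Lt (c i) (c (i + 1))) {x : M} {i j : ℕ}
    (hi : Lt (c i) x ∧ Lt x (c (i + 1))) (hj : Lt (c j) x ∧ Lt x (c (j + 1))) : i = j := by
  have mono : ∀ {i j : ℕ}, i < j → Lt (c i) (c j) := fun {i j} h => by
    have : IsTrans M Lt := ⟨fun _ _ _ => Lt.trans⟩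
    exact Nat.rel_of_forall_rel_succ_of_lt Lt hc h
  have aux : ∀ {i j : ℕ}, Lt x (c (i + 1)) → Lt (c j) x → ¬ i < j := fun {i j} h₁ h₂ hlt => by
    -- Only the strict relation is available, so adjacent intervals, which share an endpoint, are
    -- treated separately.
    rcases (Nat.succ_le_of_lt hlt).eq_or_lt with h | h
    · subst h
      exact Lt.irrefl x (h₁.trans h₂)
    · exact Lt.irrefl x ((h₁.trans (mono h)).trans h₂)
  exact le_antisymm (not_lt.1 (aux hj.2 hi.1)) (not_lt.1 (aux hi.2 hj.1))

end Models

/-! ### The array of intervals and the two patterns -/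

/-- Since `t` is transcendental, evaluation at `t` is injective on polynomials and carries the
monomial basis to an independent family. -/
theorem linearIndependent_X_pow (r : ℕ) :
    LinearIndependent ℚ (fun i : Fin r => (RatFunc.X : RatFunc ℚ) ^ (i : ℕ)) := by
  have h : LinearIndependent ℚ (fun i : ℕ => (RatFunc.X : RatFunc ℚ) ^ i) := by
    have ht : Transcendental ℚ (RatFunc.X : RatFunc ℚ) := by
      convert RatFunc.transcendental_X (K := ℚ)
      exact Subsingleton.elim _ _
    have h := (Polynomial.basisMonomials ℚ).linearIndependent.map'
      (Polynomial.aeval (RatFunc.X : RatFunc ℚ)).toLinearMap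
      (LinearMap.ker_eq_bot.2 (transcendental_iff_injective.1 ht))
    have e : (fun i : ℕ => (RatFunc.X : RatFunc ℚ) ^ i) =
        (Polynomial.aeval (RatFunc.X : RatFunc ℚ)).toLinearMap ∘ Polynomial.basisMonomials ℚ := by
      funext i
      simp
    rw [e]
    exact h
  exact h.comp _ Fin.val_injective

/-- The formula `y_0 < λ_q(x) < y_1`. -/
def intervalF (q : RatFunc ℚ) : tLang.Formula (Fin 1 ⊕ Fin 2) :=
  ltF (Term.var (Sum.inr 0)) (lamT q (Term.var (Sum.inl 0))) ⊓
    ltF (lamT q (Term.var (Sum.inl 0))) (Term.var (Sum.inr 1))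

theorem realize_intervalF {M : Type} [tLang.Structure M] {q : RatFunc ℚ} {a : Fin 1 → M}
    {b : Fin 2 → M} : (intervalF q).Realize (Sum.elim a b) ↔
      Lt (b 0) (lam q (a 0)) ∧ Lt (lam q (a 0)) (b 1) := by
  simp [intervalF]

section Array

variable {M : Type} [tLang.Structure M] [hM : M ⊨ theoryT] {c : ℕ → M}

/-- In an elementary extension, the intervals between consecutive terms of an increasing sequence
of the small model are disjoint. -/
theorem eq_of_realize_intervalF (hc : ∀ i, Lt (c i) (c (i + 1))) {N : Type} [tLang.Structure N]
    (g : M ↪ₑ[tLang] N) {q : RatFunc ℚ} {a : Fin 1 → N} {i j : ℕ}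
    (hi : (intervalF q).Realize (Sum.elim a (g ∘ ![c i, c (i + 1)])))
    (hj : (intervalF q).Realize (Sum.elim a (g ∘ ![c j, c (j + 1)]))) : i = j := by
  -- The realization lives in `N`, so the disjointness argument is rerun there for the sequence `g ∘
  -- c`.
  have : N ⊨ theoryT := (g.theory_model_iff theoryT).1 hM
  have hgc : ∀ i, Lt (g (c i)) (g (c (i + 1))) := fun i => by
    have h := g.map_formula (ltF (Term.var 0) (Term.var 1)) ![c i, c (i + 1)]
    simp only [realize_ltF, Term.realize_var] at h
    exact h.2 (hc i)
  exact eq_of_mem_intervals (c := g ∘ c) hgc (realize_intervalF.1 hi) (realize_intervalF.1 hj)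

/-- The first `r` conditions of a path ask that `(x, λ_t(x), …, λ_{t^(r-1)}(x))` lie in an open box,
which density provides. -/
theorem consistent_intervalF_path [Nonempty M] (hc : ∀ i, Lt (c i) (c (i + 1))) (f : ℕ → ℕ) :
    Consistent 1 (fun j : ℕ => intervalF (RatFunc.X ^ j))
      (fun j => ![c (f j), c (f j + 1)]) := by
  refine consistent_of_forall_initial fun r => ?_
  obtain ⟨x, hx⟩ := exists_lam_mem_box (linearIndependent_X_pow r)
    (a := fun i : Fin r => c (f i)) (b := fun i : Fin r => c (f i + 1)) fun i => hc _
  exact ⟨fun _ => x, fun k hk => realize_intervalF.2 (hx ⟨k, hk⟩)⟩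

end Array

theorem hasInpPattern_of_isSatisfiable {T' : tLang.Theory} (hsub : theoryT ⊆ T')
    (hsat : T'.IsSatisfiable) : HasInpPattern T' 1 ℕ := by
  obtain ⟨M⟩ := hsat
  have : (M : Type) ⊨ theoryT := Theory.Model.mono (T := theoryT) M.is_model hsub
  obtain ⟨c, hc⟩ := exists_increasing_sequence (M := (M : Type))
  refine ⟨M, fun _ => 2, fun j => intervalF (RatFunc.X ^ j), fun _ => 2,
    fun _ i => ![c i, c (i + 1)], fun j s hs => ?_, consistent_intervalF_path hc⟩
  rintro ⟨N, _, g, a, ha⟩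
  obtain ⟨i, i', hne, rfl⟩ := Finset.card_eq_two.1 hs
  exact hne (eq_of_realize_intervalF hc g (ha ⟨i, by simp⟩) (ha ⟨i', by simp⟩))

theorem hasIctPattern_of_isSatisfiable {T' : tLang.Theory} (hsub : theoryT ⊆ T')
    (hsat : T'.IsSatisfiable) : HasIctPattern T' 1 ℕ := by
  obtain ⟨M⟩ := hsat
  have : (M : Type) ⊨ theoryT := Theory.Model.mono (T := theoryT) M.is_model hsub
  obtain ⟨c, hc⟩ := exists_increasing_sequence (M := (M : Type))
  refine ⟨M, fun _ => 2, fun j => intervalF (RatFunc.X ^ j),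
    fun _ i => ![c i, c (i + 1)], fun f => ?_⟩
  obtain ⟨N, _, g, a, ha⟩ := consistent_intervalF_path hc f
  refine ⟨N, inferInstance, g, a, fun ⟨j, i⟩ => ?_⟩
  by_cases h : i = f j
  · simpa only [h, if_true] using ha j
  -- Row `j` already holds at `f j`, and its intervals are disjoint, so the entry at `i ≠ f j`
  -- fails.
  · simp only [h, if_false, Formula.realize_not]
    exact fun hi => h (eq_of_realize_intervalF hc g hi (ha j))

end DenseVS

theorem mainTheorem9 (T' : DenseVS.tLang.Theory)
    (hT' : DenseVS.IsCompletion T' DenseVS.theoryT) :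
    ¬ DenseVS.IsStrong T' ∧
      DenseVS.HasInpPattern T' 1 ℕ ∧ DenseVS.HasIctPattern T' 1 ℕ := by
  have hinp := DenseVS.hasInpPattern_of_isSatisfiable hT'.1 hT'.2.1
  exact ⟨fun h => h 1 hinp, hinp, DenseVS.hasIctPattern_of_isSatisfiable hT'.1 hT'.2.1⟩
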